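/- A $C$-group is a group $G$ together with a finite presentation $$G=\langle x_1,\dots,x_m \mid x_i=w_{i,j,k}^{-1}x_jw_{i,j,k},\ 1\le i,j\le m,\ 1\le k\le h(i,j)\rangle ,\qquad m\ge 1,$$ where the $w_{i,j,k}$ are elements of the free group on $x_1,\dots,x_m$ and $h(i,j)\ge 0$ are integers; its $C$-generators are the conjugates in $G$ of $x_1,\dots,x_m$, and $C$-groups are considered up to $C$-isomorphism, that is, group isomorphism matching the sets of $C$-generators. A $C$-group is a Hurwitz $C$-group if it is $C$-isomorphic to one given by such a presentation in which $h(i,i)\ge 1$ and $w_{i,i,1}=x_1x_2\cdots x_m$ for every $i=1,\dots,m$. (So $x_1\cdots x_m$ is central.) Let $\nu:G\to\mathbb Z$ be the homomorphism sending every $C$-generator to $1$, let $N=\ker\nu$ with commutator subgroup $N'$, and let $h_{\mathbb C}$ be the automorphism of $(N/N')\otimes_{\mathbb Z}\mathbb C$ induced by the conjugation $g\mapsto x^{-1}gx$ of $N$ by a $C$-generator $x$ (it does not depend on the choice of $x$). The Alexander polynomial of $G$ is $\Delta(t)=\det(h_{\mathbb C}-t\,\mathrm{Id})$ if $(N/N')\otimes\mathbb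 C$ is finite dimensional, and $\Delta(t)=0$ otherwise. **Theorem.** Let $n,k\ge 0$ be integers. The polynomial $(-1)^{n+k}(t-1)^n(t+1)^k$ is the Alexander polynomial of some Hurwitz $C$-group if and only if $n\ge k$. -/

import Mathlib

open Polynomial TensorProduct

/-- A `C`-group: a group together with a finite presentation by generators `x_i` (`i : Fin m`,
with `m ≥ 1`) and relations `x_i = w_{i,j,k}⁻¹ x_j w_{i,j,k}` (`k : Fin (h i j)`), where the
`w_{i,j,k}` are arbitrary elements of the free group on the `x_i`. The structure records the
presentation; the group is `CGroup.Carrier`. -/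
structure CGroup where
  /-- the number of generators -/
  m : ℕ
  m_pos : 0 < m
  /-- `h i j` is the number of relations of the form `x_i = w⁻¹ x_j w` -/
  h : Fin m → Fin m → ℕ
  /-- the conjugating words -/
  w : (i j : Fin m) → Fin (h i j) → FreeGroup (Fin m)

namespace CGroup

/-- The relators `x_i⁻¹ (w_{i,j,k}⁻¹ x_j w_{i,j,k})` of the presentation. -/
def relators (P : CGroup) : Set (FreeGroup (Fin P.m)) :=
  {r | ∃ (i j : Fin P.m) (k : Fin (P.h i j)),
    r = (FreeGroup.of i)⁻¹ * ((P.w i j k)⁻¹ * FreeGroup.of j * P.w i j k)}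

/-- The group defined by the presentation. -/
abbrev Carrier (P : CGroup) : Type := PresentedGroup P.relators

/-- The image of the `i`-th free generator in the group. -/
def gen (P : CGroup) (i : Fin P.m) : P.Carrier := PresentedGroup.of i

/-- The `C`-generators: the elements conjugate to one of the `x_i`. -/
def cGenerators (P : CGroup) : Set P.Carrier :=
  {g | ∃ i : Fin P.m, IsConj (P.gen i) g}

/-- `C`-isomorphism: a group isomorphism such that it and its inverse send `C`-generators to
`C`-generators. -/
def IsCIso (P Q : CGroup) (e : P.Carrier ≃* Q.Carrier) : Prop :=
  ∀ g : P.Carrier, g ∈ P.cGenerators ↔ e g ∈ Q.cGenerators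

/-- The presentation is a Hurwitz `C`-presentation: for each `i`, the first word `w_{i,i,1}` is
the product `x_1 ⋯ x_m`. -/
def IsHurwitzPresentation (P : CGroup) : Prop :=
  ∀ i : Fin P.m, ∃ hi : 0 < P.h i i,
    P.w i i ⟨0, hi⟩ = (List.ofFn (fun j : Fin P.m => FreeGroup.of j)).prod

/-- A Hurwitz `C`-group: a `C`-group which possesses, up to `C`-isomorphism, a Hurwitz
`C`-presentation. -/
def IsHurwitz (P : CGroup) : Prop :=
  ∃ Q : CGroup, Q.IsHurwitzPresentation ∧ ∃ e : Q.Carrier ≃* P.Carrier, IsCIso Q P e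

theorem lift_relators (P : CGroup) : ∀ r ∈ P.relators,
    FreeGroup.lift (fun _ : Fin P.m => Multiplicative.ofAdd (1 : ℤ)) r = 1 := by
  rintro r ⟨i, j, k, rfl⟩
  simp [mul_comm]

/-- The canonical epimorphism `ν` onto the infinite cyclic group (written `Multiplicative ℤ`),
sending every `x_i`, hence every `C`-generator, to the generator. -/
def nu (P : CGroup) : P.Carrier →* Multiplicative ℤ :=
  PresentedGroup.toGroup P.lift_relators

/-- The kernel `N` of `ν`. -/
abbrev N (P : CGroup) : Subgroup P.Carrier := P.nu.ker

/-- The abelian group `N / N'`, written additively. -/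
abbrev NAb (P : CGroup) : Type := Additive (Abelianization P.N)

/-- The endomorphism of `N / N'` induced by the conjugation `g ↦ x⁻¹ g x` of `N`. -/
noncomputable def conjAction (P : CGroup) (x : P.Carrier) : P.NAb →ₗ[ℤ] P.NAb :=
  (MonoidHom.toAdditive (Abelianization.map
    (MulAut.conjNormal (H := P.N) x⁻¹).toMonoidHom)).toIntLinearMap

/-- The action `h_ℂ` on `(N / N') ⊗ ℂ`, given by conjugation by a generator `x`
of the presentation; the choice of `x` does not matter, and we take the first one. -/
noncomputable def hC (P : CGroup) : (ℂ ⊗[ℤ] P.NAb) →ₗ[ℂ] (ℂ ⊗[ℤ] P.NAb) :=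
  (P.conjAction (P.gen ⟨0, P.m_pos⟩)).baseChange ℂ

open Classical in
/-- The Alexander polynomial `Δ(t) = det (h_ℂ - t Id)`, which is `(-1) ^ d` times the monic
characteristic polynomial `det (t Id - h_ℂ)`, where `d` is the dimension of `(N / N') ⊗ ℂ`.
It is `0` by definition if this space is infinite dimensional. -/
noncomputable def alexander (P : CGroup) : ℂ[X] :=
  if _hfin : Module.Finite ℂ (ℂ ⊗[ℤ] P.NAb) then
    (-1) ^ Module.finrank ℂ (ℂ ⊗[ℤ] P.NAb) * P.hC.charpoly
  else 0

end CGroup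

/-! Duality turns eigenspaces of `hC` into crossed homomorphisms: an additive map `N / N' → ℂ` with
eigenvalue `μ` is the restriction of a unique `f : G → ℂ` with `f (g h) = f g + χ g * f h`, where
`χ` sends each generator to `μ⁻¹` and `f` vanishes at the base generator (`crossed_mul`,
`exists_crossed_eq`).

In a Hurwitz `C`-group a central element has nonzero `ν`, so `hC` has finite order and is
semisimple; `n` and `k` are then the dimensions of the eigenspaces for `1` and `-1`. Let `c` be the
number of conjugacy classes of generators. For `μ = 1` the crossed homomorphisms are homomorphisms,
free on the classes, so `n ≥ c - 1`. For `μ = -1`, one vanishing at a representative of each class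
has all its values in twice the lattice that they span, hence is zero (`crossed_gen_eq_zero`), so `k
≤ c - 1`.

Conversely, `pairGroup n k` has generators equal in pairs, giving `n + 1` classes. Making `x_i ^ 2`
or `x_i x_0⁻¹` central leaves exactly `k` free parameters for `μ = -1`, realised by reflections of
`ℂ`. -/

section LinearAlgebra

/-! ### Eigenspaces and characteristic polynomials of maps of finite order -/

variable {K V : Type*} [Field K] [AddCommGroup V] [Module K V] [Module.Finite K V]

theorem finrank_eigenspace_dualMap (f : Module.End K V) (μ : K) :
    Module.finrank K (Module.End.eigenspace (M := Module.Dual K V) f.dualMap μ) =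
      Module.finrank K (f.eigenspace μ) := by
  have h1 : (LinearMap.dualMap (f - μ • (1 : Module.End K V))) =
      (f.dualMap : Module.End K (Module.Dual K V)) - μ • (1 : Module.End K (Module.Dual K V)) := by
    ext φ v
    simp
  rw [Module.End.eigenspace_def, Module.End.eigenspace_def, ← h1]
  have h2 := LinearMap.finrank_range_dualMap_eq_finrank_range
    (f - μ • (1 : Module.End K V))
  have h3 := LinearMap.finrank_range_add_finrank_ker (f - μ • (1 : Module.End K V))
  have h4 := LinearMap.finrank_range_add_finrank_ker
    (LinearMap.dualMap (f - μ • (1 : Module.End K V)))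
  rw [Subspace.dual_finrank_eq] at h4
  omega

variable [CharZero K]

/-- `X ^ d - 1` is separable in characteristic zero, so `f` is semisimple and its generalized
eigenspaces are eigenspaces. -/
theorem rootMultiplicity_charpoly_of_pow_eq_one {f : Module.End K V} {d : ℕ} (hd : d ≠ 0)
    (hf : f ^ d = 1) (μ : K) :
    f.charpoly.rootMultiplicity μ = Module.finrank K (f.eigenspace μ) := by
  have hs : f.IsSemisimple := by
    refine Module.End.isSemisimple_of_squarefree_aeval_eq_zero (p := X ^ d - C 1)
      (separable_X_pow_sub_C (1 : K) (by exact_mod_cast hd) one_ne_zero).squarefree ?_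
    simp [hf]
  rw [← LinearMap.finrank_maxGenEigenspace_eq,
    hs.isFinitelySemisimple.maxGenEigenspace_eq_eigenspace]

theorem charpoly_of_sq_eq_one [IsAlgClosed K] {f : Module.End K V} (hf : f ^ 2 = 1) :
    f.charpoly = (X - 1) ^ Module.finrank K (f.eigenspace 1) *
      (X + 1) ^ Module.finrank K (f.eigenspace (-1)) := by
  have key : f.charpoly.roots = Multiset.replicate (Module.finrank K (f.eigenspace 1)) 1 +
      Multiset.replicate (Module.finrank K (f.eigenspace (-1))) (-1) := by
    classical
    ext μ
    rw [count_roots, Multiset.count_add, Multiset.count_replicate, Multiset.count_replicate]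
    by_cases h1 : μ = 1
    · subst h1
      rw [rootMultiplicity_charpoly_of_pow_eq_one two_ne_zero hf, if_pos rfl, if_neg, add_zero]
      intro h
      norm_num [neg_eq_iff_add_eq_zero] at h
    by_cases h2 : μ = -1
    · subst h2
      rw [rootMultiplicity_charpoly_of_pow_eq_one two_ne_zero hf, if_pos rfl, if_neg, zero_add]
      exact fun h => h1 h.symm
    rw [if_neg (Ne.symm h1), if_neg (Ne.symm h2), add_zero]
    refine rootMultiplicity_eq_zero fun hr => ?_
    obtain ⟨v, hv⟩ := ((f.hasEigenvalue_iff_isRoot_charpoly μ).2 hr).exists_hasEigenvector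
    have h3 : (f ^ 2) v = μ ^ 2 • v := hv.pow_apply 2
    rw [hf] at h3
    have h4 : (μ ^ 2 - 1) • v = 0 := by rw [sub_smul, ← h3]; simp
    rcases smul_eq_zero.1 h4 with h | h
    · rcases sq_eq_sq_iff_eq_or_eq_neg.1 ((sub_eq_zero.1 h).trans (one_pow 2).symm) with h | h
      · exact h1 h
      · exact h2 h
    · exact hv.2 h
  have hsp := (IsAlgClosed.splits f.charpoly).eq_prod_roots_of_monic f.charpoly_monic
  rw [key] at hsp
  rw [hsp]
  simp

theorem rootMultiplicity_sub_one_pow_mul_add_one_pow (n k : ℕ) :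
    ((X - 1) ^ n * (X + 1) ^ k : K[X]).rootMultiplicity 1 = n ∧
      ((X - 1) ^ n * (X + 1) ^ k : K[X]).rootMultiplicity (-1) = k := by
  have e : ((X - 1) ^ n * (X + 1) ^ k : K[X]) = (X - C 1) ^ n * (X - C (-1)) ^ k := by simp
  have h1 : (1 : K) ≠ -1 := by
    intro h
    norm_num [eq_neg_iff_add_eq_zero] at h
  have hne : ((X - C 1) ^ n * (X - C (-1)) ^ k : K[X]) ≠ 0 :=
    (((monic_X_sub_C _).pow n).mul ((monic_X_sub_C _).pow k)).ne_zero
  classical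
  rw [e, rootMultiplicity_mul hne, rootMultiplicity_mul hne]
  simp only [← count_roots, roots_pow, roots_X_sub_C, Multiset.count_nsmul,
    Multiset.count_singleton]
  simp [h1, h1.symm]

end LinearAlgebra

/-- Allows characteristic polynomials to be compared before the dimension, hence the sign, is known.
-/
theorem eq_of_neg_one_pow_mul_eq {K : Type*} [Field K] [CharZero K] {p q : K[X]} (hp : p.Monic)
    (hq : q.Monic) {a b : ℕ} (h : (-1 : K[X]) ^ a * p = (-1) ^ b * q) : p = q := by
  have hne : p ≠ -q := by
    intro e
    have := congrArg leadingCoeff e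
    rw [leadingCoeff_neg, hp.leadingCoeff, hq.leadingCoeff] at this
    norm_num [eq_neg_iff_add_eq_zero] at this
  rcases neg_one_pow_eq_or K[X] a with ha | ha <;> rcases neg_one_pow_eq_or K[X] b with hb | hb <;>
    rw [ha, hb] at h
  · simpa using h
  · exact (hne (by simpa using h)).elim
  · exact (hne (by rw [← neg_eq_iff_eq_neg]; simpa using h)).elim
  · simpa using h

/-! ### Eigenvectors on `N / N'` and crossed homomorphisms -/

namespace CGroup

variable (P : CGroup)

/-- The first generator of the presentation. -/
def base : P.Carrier := P.gen ⟨0, P.m_pos⟩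

/-- The class of an element of `N` in `N / N'`. -/
def cls (a : P.N) : P.NAb := Additive.ofMul (Abelianization.of a)

theorem closure_range_gen : Subgroup.closure (Set.range P.gen) = ⊤ :=
  PresentedGroup.closure_range_of P.relators

@[simp] theorem nu_gen (i : Fin P.m) : P.nu (P.gen i) = Multiplicative.ofAdd 1 := by
  simp [nu, gen]

@[simp] theorem nu_base : P.nu P.base = Multiplicative.ofAdd 1 := P.nu_gen _

/-- The element `g x₀ ^ (-ν g)` of `N`. -/
def toN (g : P.Carrier) : P.N :=
  ⟨g * P.base ^ (-(P.nu g).toAdd), by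
    rw [MonoidHom.mem_ker, map_mul, map_zpow, nu_base, ← ofAdd_zsmul]
    simp [ofAdd_neg]⟩

theorem coe_toN (g : P.Carrier) : (P.toN g : P.Carrier) = g * P.base ^ (-(P.nu g).toAdd) := rfl

theorem toN_coe (a : P.N) : P.toN a = a := by
  ext
  have h : P.nu a = 1 := a.2
  simp [coe_toN, h]

theorem cls_surjective : Function.Surjective P.cls := fun x =>
  (QuotientGroup.mk_surjective x.toMul).imp fun _ h => congrArg Additive.ofMul h

theorem cls_mul (a b : P.N) : P.cls (a * b) = P.cls a + P.cls b := by
  simp [cls]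

theorem conjAction_cls (x : P.Carrier) (a : P.N) :
    P.conjAction x (P.cls a) = P.cls (MulAut.conjNormal x⁻¹ a) := rfl

theorem cls_conjNormal_coe (b a : P.N) : P.cls (MulAut.conjNormal (b : P.Carrier) a) = P.cls a := by
  have h : MulAut.conjNormal (b : P.Carrier) a = b * a * b⁻¹ := by ext; simp
  rw [h]
  simp [cls]

/-- The additive maps `N / N' → ℂ` which are eigenvectors for conjugation by `x₀`. -/
noncomputable def eigenHom (μ : ℂˣ) : Submodule ℂ (P.NAb →ₗ[ℤ] ℂ) where
  carrier := {φ | φ ∘ₗ P.conjAction P.base = (μ : ℂ) • φ}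
  add_mem' {φ ψ} h1 h2 := by
    simp only [Set.mem_ofPred_eq] at *
    rw [LinearMap.add_comp, h1, h2, smul_add]
  zero_mem' := by simp
  smul_mem' c φ h := by
    simp only [Set.mem_ofPred_eq] at *
    rw [LinearMap.smul_comp, h, smul_comm]

/-- The character of the group sending each generator to `μ⁻¹`. -/
def chi (μ : ℂˣ) : P.Carrier →* ℂˣ := (zpowersHom ℂˣ μ⁻¹).comp P.nu

theorem chi_eq_of_nu_eq (μ : ℂˣ) {g g' : P.Carrier} (h : P.nu g = P.nu g') :
    P.chi μ g = P.chi μ g' := by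
  simp [chi, h]

@[simp] theorem chi_gen (μ : ℂˣ) (i : Fin P.m) : P.chi μ (P.gen i) = μ⁻¹ := by
  simp [chi]

@[simp] theorem chi_base (μ : ℂˣ) : P.chi μ P.base = μ⁻¹ := P.chi_gen μ _

theorem chi_coe (μ : ℂˣ) (a : P.N) : P.chi μ (a : P.Carrier) = 1 := by
  have h : P.nu a = 1 := a.2
  simp [chi, h]

theorem nu_base_zpow_nu (g : P.Carrier) : P.nu (P.base ^ (P.nu g).toAdd) = P.nu g := by
  rw [map_zpow, nu_base, ← ofAdd_zsmul]
  simp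

variable {P} {μ : ℂˣ} {φ : P.NAb →ₗ[ℤ] ℂ}

/-- `N` acts trivially on `N / N'`, so every generator acts as `x₀` does. The inverse in `chi`
appears because `conjAction` conjugates by `x⁻¹`. -/
theorem apply_conjNormal_of_mem_eigenHom (hφ : φ ∈ P.eigenHom μ) (g : P.Carrier) (a : P.N) :
    φ (P.cls (MulAut.conjNormal g a)) = P.chi μ g * φ (P.cls a) := by
  have hbase : ∀ a, φ (P.cls (MulAut.conjNormal P.base a)) = P.chi μ P.base * φ (P.cls a) := by
    intro a
    have h := LinearMap.congr_fun (show φ ∘ₗ P.conjAction P.base = (μ : ℂ) • φ from hφ)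
      (P.cls (MulAut.conjNormal P.base a))
    rw [LinearMap.comp_apply, conjAction_cls, ← MulAut.mul_apply, ← map_mul, inv_mul_cancel,
      map_one, MulAut.one_apply, LinearMap.smul_apply, smul_eq_mul] at h
    rw [h, chi_base, Units.inv_mul_cancel_left]
  have hg : g ∈ Subgroup.closure (Set.range P.gen) := by
    rw [closure_range_gen]
    trivial
  induction hg using Subgroup.closure_induction generalizing a with
  | mem x hx =>
    obtain ⟨i, rfl⟩ := hx
    have h : P.gen i = (P.toN (P.gen i) : P.Carrier) * P.base := by simp [coe_toN]
    rw [h, map_mul, MulAut.mul_apply, cls_conjNormal_coe, hbase, map_mul, chi_coe, one_mul]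
  | one => simp
  | mul x y _ _ hx hy => rw [map_mul, MulAut.mul_apply, hx, hy, map_mul, Units.val_mul, mul_assoc]
  | inv x _ hx =>
    have h := hx (MulAut.conjNormal x⁻¹ a)
    rw [← MulAut.mul_apply, ← map_mul, mul_inv_cancel, map_one, MulAut.one_apply] at h
    rw [h, map_inv (P.chi μ), Units.inv_mul_cancel_left]

/-- The crossed homomorphism on the whole group attached to an additive map on `N / N'`. -/
def crossed (φ : P.NAb →ₗ[ℤ] ℂ) (g : P.Carrier) : ℂ := φ (P.cls (P.toN g))

theorem crossed_mul (hφ : φ ∈ P.eigenHom μ) (g h : P.Carrier) :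
    crossed φ (g * h) = crossed φ g + P.chi μ g * crossed φ h := by
  have e : P.toN (g * h) =
      P.toN g * MulAut.conjNormal (P.base ^ (P.nu g).toAdd) (P.toN h) := by
    ext
    simp only [coe_toN, Subgroup.coe_mul, MulAut.conjNormal_apply, map_mul, toAdd_mul, neg_add,
      zpow_add, zpow_neg]
    rw [(Commute.refl P.base).zpow_zpow _ _ |>.inv_inv.eq]
    group
  rw [crossed, e, cls_mul, map_add, apply_conjNormal_of_mem_eigenHom hφ,
    chi_eq_of_nu_eq P μ (P.nu_base_zpow_nu g)]
  rfl

theorem crossed_coe (φ : P.NAb →ₗ[ℤ] ℂ) (a : P.N) : crossed φ a = φ (P.cls a) := by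
  rw [crossed, toN_coe]

@[simp] theorem crossed_base (φ : P.NAb →ₗ[ℤ] ℂ) : crossed φ P.base = 0 := by
  have h : P.toN P.base = 1 := by ext; simp [coe_toN]
  rw [crossed, h]
  exact map_zero φ

@[simp] theorem crossed_one (φ : P.NAb →ₗ[ℤ] ℂ) : crossed φ 1 = 0 := by
  have h := crossed_coe φ 1
  rw [Subgroup.coe_one] at h
  rw [h]
  exact map_zero φ

theorem crossed_inv (hφ : φ ∈ P.eigenHom μ) (g : P.Carrier) :
    crossed φ g⁻¹ = -(P.chi μ g⁻¹ * crossed φ g) := by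
  have h := crossed_mul hφ g⁻¹ g
  rw [inv_mul_cancel, crossed_one] at h
  exact eq_neg_of_add_eq_zero_left h.symm

theorem eq_zero_of_crossed_gen (hφ : φ ∈ P.eigenHom μ) (h : ∀ i, crossed φ (P.gen i) = 0) :
    φ = 0 := by
  have key : ∀ g, crossed φ g = 0 := by
    intro g
    have hg : g ∈ Subgroup.closure (Set.range P.gen) := by
      rw [closure_range_gen]
      trivial
    induction hg using Subgroup.closure_induction with
    | mem x hx =>
      obtain ⟨i, rfl⟩ := hx
      exact h i
    | one => simp
    | mul x y _ _ hx hy => rw [crossed_mul hφ, hx, hy, mul_zero, add_zero]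
    | inv x _ hx => rw [crossed_inv hφ, hx, mul_zero, neg_zero]
  ext x
  obtain ⟨a, rfl⟩ := P.cls_surjective x
  rw [← crossed_coe, key, LinearMap.zero_apply]

/-- Since `χ` is trivial on `N`, `f` restricts to a homomorphism there; vanishing at `x₀` makes `f`
insensitive to the factor `x₀ ^ (-ν g)` in `toN`. -/
theorem exists_crossed_eq (f : P.Carrier → ℂ)
    (hf : ∀ g h, f (g * h) = f g + P.chi μ g * f h) (h0 : f P.base = 0) :
    ∃ φ ∈ P.eigenHom μ, ∀ g, crossed φ g = f g := by
  have h1 : f 1 = 0 := by simpa using hf 1 1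
  have hinv : f P.base⁻¹ = 0 := by
    have := hf P.base⁻¹ P.base
    rw [inv_mul_cancel, h1, h0, mul_zero, add_zero] at this
    exact this.symm
  have hz : ∀ n : ℤ, f (P.base ^ n) = 0 := by
    intro n
    induction n using Int.induction_on with
    | zero => simpa using h1
    | succ n ih => rw [zpow_add_one, hf, ih, h0, mul_zero, add_zero]
    | pred n ih => rw [zpow_sub_one, hf, ih, hinv, mul_zero, add_zero]
  let F : P.N →* Multiplicative ℂ :=
    { toFun := fun a => Multiplicative.ofAdd (f a)
      map_one' := by simp [h1]
      map_mul' := fun a b => by simp [hf, chi_coe] }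
  let φ : P.NAb →ₗ[ℤ] ℂ := (MonoidHom.toAdditiveLeft (Abelianization.lift F)).toIntLinearMap
  have hφ : ∀ a, φ (P.cls a) = f a := fun a => rfl
  refine ⟨φ, ?_, fun g => ?_⟩
  · change φ ∘ₗ P.conjAction P.base = (μ : ℂ) • φ
    ext x
    obtain ⟨a, rfl⟩ := P.cls_surjective x
    rw [LinearMap.comp_apply, conjAction_cls, hφ, LinearMap.smul_apply, hφ,
      MulAut.conjNormal_apply, inv_inv, hf, h0, mul_zero, add_zero, hf, hinv, zero_add, map_inv,
      chi_base, inv_inv, smul_eq_mul]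
  · rw [crossed, hφ, coe_toN, hf, hz, mul_zero, add_zero]

end CGroup

/-! ### Dimensions of the eigenspaces of `hC` -/

namespace CGroup

variable {P : CGroup}

theorem liftBaseChange_mem_eigenspace_iff (μ : ℂˣ) (φ : P.NAb →ₗ[ℤ] ℂ) :
    LinearMap.liftBaseChangeEquiv ℂ φ ∈ Module.End.eigenspace
      (M := Module.Dual ℂ (ℂ ⊗[ℤ] P.NAb)) P.hC.dualMap (μ : ℂ) ↔ φ ∈ P.eigenHom μ := by
  rw [Module.End.mem_eigenspace_iff]
  have e1 : P.hC.dualMap (LinearMap.liftBaseChangeEquiv ℂ φ) =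
      LinearMap.liftBaseChangeEquiv ℂ (φ ∘ₗ P.conjAction P.base) := by
    ext x
    simp [hC, base]
  rw [e1, ← map_smul]
  exact (LinearMap.liftBaseChangeEquiv ℂ).injective.eq_iff

theorem finrank_eigenspace_hC [Module.Finite ℂ (ℂ ⊗[ℤ] P.NAb)] (μ : ℂˣ) :
    Module.finrank ℂ (Module.End.eigenspace P.hC (μ : ℂ)) =
      Module.finrank ℂ (P.eigenHom μ) := by
  rw [← finrank_eigenspace_dualMap]
  have h : P.eigenHom μ = (Module.End.eigenspace
      (M := Module.Dual ℂ (ℂ ⊗[ℤ] P.NAb)) P.hC.dualMap (μ : ℂ)).comap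
      (LinearMap.liftBaseChangeEquiv ℂ : _ ≃ₗ[ℂ] (ℂ ⊗[ℤ] P.NAb →ₗ[ℂ] ℂ)).toLinearMap := by
    ext φ
    exact (liftBaseChange_mem_eigenspace_iff μ φ).symm
  rw [h]
  exact (LinearEquiv.finrank_eq (LinearEquiv.ofSubmodule' _ _)).symm

theorem conjAction_pow_cls (x : P.Carrier) (d : ℕ) (a : P.N) :
    (P.conjAction x ^ d : Module.End ℤ P.NAb) (P.cls a) =
      P.cls (MulAut.conjNormal (x ^ d)⁻¹ a) := by
  induction d generalizing a with
  | zero => simp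
  | succ d ih =>
    rw [pow_succ, Module.End.mul_apply, conjAction_cls, ih, ← MulAut.mul_apply, ← map_mul,
      ← mul_inv_rev, ← pow_succ']

/-- Modulo `N`, `x₀ ^ d` equals the central element `z`, and both `z` and `N` act trivially on `N /
N'`. -/
theorem conjAction_pow_eq_one {z : P.Carrier} (hz : z ∈ Subgroup.center P.Carrier) {d : ℕ}
    (hd : P.nu z = Multiplicative.ofAdd (d : ℤ)) :
    (P.conjAction P.base ^ d : Module.End ℤ P.NAb) = 1 := by
  ext x
  obtain ⟨a, rfl⟩ := P.cls_surjective x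
  rw [conjAction_pow_cls, Module.End.one_apply]
  have hb : (P.base ^ d)⁻¹ * z ∈ P.N := by
    rw [MonoidHom.mem_ker, map_mul, map_inv, map_pow, nu_base, hd, ← ofAdd_nsmul]
    simp
  have h : MulAut.conjNormal (P.base ^ d)⁻¹ a =
      MulAut.conjNormal (((⟨_, hb⟩ : P.N) : P.Carrier)) a := by
    ext
    have hc := Subgroup.mem_center_iff.1 hz
    simp only [MulAut.conjNormal_apply, mul_inv_rev, mul_assoc]
    rw [← mul_assoc z, ← hc, mul_assoc, mul_inv_cancel_left]
  rw [h, cls_conjNormal_coe]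

theorem hC_pow_eq_one {d : ℕ} (h : (P.conjAction P.base ^ d : Module.End ℤ P.NAb) = 1) :
    P.hC ^ d = 1 := by
  change LinearMap.baseChange ℂ (P.conjAction P.base) ^ d = 1
  rw [← LinearMap.baseChange_pow, h]
  exact LinearMap.baseChange_id

/-- The values at chosen generators of the crossed homomorphism attached to an eigenvector. -/
def evalGens (P : CGroup) (μ : ℂˣ) {T : Type*} (τ : T → Fin P.m) :
    P.eigenHom μ →ₗ[ℂ] (T → ℂ) where
  toFun φ t := crossed φ.1 (P.gen (τ t))
  map_add' _ _ := rfl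
  map_smul' _ _ := rfl

theorem evalGens_id_injective (P : CGroup) (μ : ℂˣ) :
    Function.Injective (P.evalGens μ (T := Fin P.m) id) := by
  rw [injective_iff_map_eq_zero]
  rintro ⟨φ, hφ⟩ h
  ext1
  exact eq_zero_of_crossed_gen hφ fun i => congrFun h i

instance (μ : ℂˣ) : Module.Finite ℂ (P.eigenHom μ) :=
  Module.Finite.of_injective _ (P.evalGens_id_injective μ)

theorem finrank_eigenHom_le {μ : ℂˣ} {T : Type*} [Fintype T] (τ : T → Fin P.m)
    (h : ∀ φ ∈ P.eigenHom μ, (∀ t, crossed φ (P.gen (τ t)) = 0) →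
      ∀ i, crossed φ (P.gen i) = 0) :
    Module.finrank ℂ (P.eigenHom μ) ≤ Fintype.card T := by
  rw [← Module.finrank_fintype_fun_eq_card (R := ℂ) (η := T)]
  refine LinearMap.finrank_le_finrank_of_injective (f := P.evalGens μ τ) ?_
  rw [injective_iff_map_eq_zero]
  rintro ⟨φ, hφ⟩ h0
  ext1
  exact eq_zero_of_crossed_gen hφ (h φ hφ fun t => congrFun h0 t)

theorem le_finrank_eigenHom {μ : ℂˣ} {T : Type*} [Fintype T] (τ : T → Fin P.m)
    (h : ∀ u : T → ℂ, ∃ f : P.Carrier → ℂ, (∀ g g', f (g * g') = f g + P.chi μ g * f g') ∧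
      f P.base = 0 ∧ ∀ t, f (P.gen (τ t)) = u t) :
    Fintype.card T ≤ Module.finrank ℂ (P.eigenHom μ) := by
  rw [← Module.finrank_fintype_fun_eq_card (R := ℂ) (η := T)]
  refine LinearMap.finrank_le_finrank_of_surjective (f := P.evalGens μ τ) fun u => ?_
  obtain ⟨f, hf, h0, hu⟩ := h u
  obtain ⟨φ, hφ, e⟩ := exists_crossed_eq f hf h0
  exact ⟨⟨φ, hφ⟩, funext fun t => (e _).trans (hu t)⟩

/-- The dual is the sum of the eigenspaces for `1` and `-1`, each finite dimensional because its
members are determined by their values at the generators. -/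
theorem finite_of_conjAction_sq_eq_one
    (h : (P.conjAction P.base ^ 2 : Module.End ℤ P.NAb) = 1) :
    Module.Finite ℂ (ℂ ⊗[ℤ] P.NAb) := by
  rw [← Module.finite_dual_iff ℂ]
  suffices Module.Finite ℂ (P.NAb →ₗ[ℤ] ℂ) from
    Module.Finite.equiv (LinearMap.liftBaseChangeEquiv ℂ)
  have h2 (φ : P.NAb →ₗ[ℤ] ℂ) : (φ ∘ₗ P.conjAction P.base) ∘ₗ P.conjAction P.base = φ := by
    rw [LinearMap.comp_assoc, ← Module.End.mul_eq_comp, ← pow_two, h]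
    rfl
  have htop : P.eigenHom 1 ⊔ P.eigenHom (-1) = ⊤ := by
    rw [eq_top_iff]
    intro φ _
    have e : φ = (2⁻¹ : ℂ) • (φ + φ ∘ₗ P.conjAction P.base) +
        (2⁻¹ : ℂ) • (φ - φ ∘ₗ P.conjAction P.base) := by module
    rw [e]
    refine Submodule.add_mem_sup (Submodule.smul_mem _ _ ?_) (Submodule.smul_mem _ _ ?_)
    · change _ ∘ₗ _ = _
      rw [LinearMap.add_comp, h2]
      simp [add_comm]
    · change _ ∘ₗ _ = _
      rw [LinearMap.sub_comp, h2]
      simp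
  have : Module.Finite ℂ ((P.eigenHom 1 ⊔ P.eigenHom (-1) : Submodule ℂ _)) := inferInstance
  rw [htop] at this
  exact Module.finite_def.2 (Submodule.fg_top _ |>.1 (Module.finite_def.1 this))

end CGroup

/-! ### Necessity: the inequality for Hurwitz groups -/

namespace CGroup

variable {P : CGroup}

theorem nu_of_mem_cGenerators {g : P.Carrier} (hg : g ∈ P.cGenerators) :
    P.nu g = Multiplicative.ofAdd 1 := by
  obtain ⟨i, hi⟩ := hg
  rw [← P.nu_gen i]
  exact (isConj_iff_eq.1 (P.nu.map_isConj hi)).symm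

theorem mem_center_of_commute_gen {z : P.Carrier} (h : ∀ i, Commute z (P.gen i)) :
    z ∈ Subgroup.center P.Carrier := by
  have hle : ⊤ ≤ Subgroup.centralizer {z} := by
    rw [← closure_range_gen, Subgroup.closure_le]
    rintro _ ⟨i, rfl⟩
    exact Subgroup.mem_centralizer_singleton_iff.2 (h i).symm
  exact Subgroup.mem_center_iff.2 fun g =>
    Subgroup.mem_centralizer_singleton_iff.1 (hle (Subgroup.mem_top g))

theorem gen_eq_conj (i j : Fin P.m) (k : Fin (P.h i j)) :
    P.gen i = (PresentedGroup.mk P.relators (P.w i j k))⁻¹ * P.gen j *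
      PresentedGroup.mk P.relators (P.w i j k) := by
  have h := PresentedGroup.one_of_mem (rels := P.relators) ⟨i, j, k, rfl⟩
  simp only [map_mul, map_inv] at h
  exact inv_mul_eq_one.1 h

theorem IsHurwitz.exists_mem_center (hP : P.IsHurwitz) :
    ∃ z ∈ Subgroup.center P.Carrier, ∃ d : ℕ, d ≠ 0 ∧ P.nu z = Multiplicative.ofAdd (d : ℤ) := by
  obtain ⟨Q, hQ, e, he⟩ := hP
  let W : Q.Carrier := (List.ofFn Q.gen).prod
  have hW : W ∈ Subgroup.center Q.Carrier := by
    refine mem_center_of_commute_gen fun i => ?_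
    obtain ⟨hi, hw⟩ := hQ i
    have h := gen_eq_conj i i ⟨0, hi⟩
    have hm : PresentedGroup.mk Q.relators (Q.w i i ⟨0, hi⟩) = W := by
      rw [hw, map_list_prod, List.map_ofFn]
      rfl
    rw [hm, mul_assoc, eq_inv_mul_iff_mul_eq] at h
    exact h
  refine ⟨e W, ?_, Q.m, Q.m_pos.ne', ?_⟩
  · rw [Subgroup.mem_center_iff] at hW ⊢
    intro g
    obtain ⟨g, rfl⟩ := e.surjective g
    rw [← map_mul, hW, map_mul]
  · rw [map_list_prod, map_list_prod, List.map_ofFn, List.map_ofFn]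
    have h : (P.nu ∘ e ∘ Q.gen) = fun _ => Multiplicative.ofAdd 1 := by
      ext1 i
      exact nu_of_mem_cGenerators ((he _).1 ⟨i, IsConj.refl _⟩)
    rw [h, List.ofFn_const, List.prod_replicate, ← ofAdd_nsmul]
    simp

theorem chi_neg_one_mul_self (g : P.Carrier) : (P.chi (-1) g : ℂ) * P.chi (-1) g = 1 := by
  have h : (P.chi (-1) : P.Carrier →* ℂˣ) g * P.chi (-1) g = 1 := by
    simp only [chi, MonoidHom.comp_apply, zpowersHom_apply, ← mul_zpow]
    simp
  rw [← Units.val_mul, h, Units.val_one]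

theorem crossed_mem_span {φ : P.NAb →ₗ[ℤ] ℂ} (hφ : φ ∈ P.eigenHom (-1)) (g : P.Carrier) :
    crossed φ g ∈ Submodule.span ℤ (Set.range fun i => crossed φ (P.gen i)) := by
  have hs (g : P.Carrier) (x : ℂ)
      (hx : x ∈ Submodule.span ℤ (Set.range fun i => crossed φ (P.gen i))) :
      (P.chi (-1) g : ℂ) * x ∈ Submodule.span ℤ (Set.range fun i => crossed φ (P.gen i)) := by
    rcases mul_self_eq_one_iff.1 (chi_neg_one_mul_self g) with h | h <;> rw [h]
    · simpa using hx
    · simpa using hx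
  have hg : g ∈ Subgroup.closure (Set.range P.gen) := by
    rw [closure_range_gen]
    trivial
  induction hg using Subgroup.closure_induction with
  | mem x hx =>
    obtain ⟨i, rfl⟩ := hx
    exact Submodule.subset_span ⟨i, rfl⟩
  | one => simp
  | mul x y _ _ hx hy =>
    rw [crossed_mul hφ]
    exact Submodule.add_mem _ hx (hs _ _ hy)
  | inv x _ hx =>
    rw [crossed_inv hφ]
    exact Submodule.neg_mem _ (hs _ _ hx)

theorem crossed_of_isConj {φ : P.NAb →ₗ[ℤ] ℂ} (hφ : φ ∈ P.eigenHom (-1)) {i j : Fin P.m}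
    (h : IsConj (P.gen j) (P.gen i)) (hj : crossed φ (P.gen j) = 0) :
    ∃ y, crossed φ (P.gen i) = 2 * crossed φ y := by
  obtain ⟨y, hy⟩ := isConj_iff.1 h
  refine ⟨y, ?_⟩
  have hc := chi_neg_one_mul_self y
  have hi : ((P.chi (-1) y⁻¹ : ℂˣ) : ℂ) = P.chi (-1) y := by
    rw [map_inv, Units.inv_eq_of_mul_eq_one_right hc]
  -- As `χ` is `-1` on generators, `f (y x y⁻¹) = 2 f y + χ y * f x`.
  rw [← hy, crossed_mul hφ, crossed_mul hφ, crossed_inv hφ, hj, hi, map_mul, chi_gen]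
  simp only [Units.val_mul, inv_neg, inv_one, Units.val_neg, Units.val_one]
  linear_combination (crossed φ y) * hc

/-- A crossed homomorphism for the character `-1` vanishing at one representative of each
conjugacy class of generators vanishes: its values lie in twice the lattice which they span. -/
theorem crossed_gen_eq_zero {φ : P.NAb →ₗ[ℤ] ℂ} (hφ : φ ∈ P.eigenHom (-1))
    (h : ∀ i, ∃ j, IsConj (P.gen j) (P.gen i) ∧ crossed φ (P.gen j) = 0) (i : Fin P.m) :
    crossed φ (P.gen i) = 0 := by
  set L := Submodule.span ℤ (Set.range fun i => crossed φ (P.gen i)) with hL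
  have hle : L ≤ Ideal.span {(2 : ℤ)} • L := by
    refine Submodule.span_le.2 ?_
    rintro _ ⟨i, rfl⟩
    obtain ⟨j, hj, h0⟩ := h i
    obtain ⟨y, hy⟩ := crossed_of_isConj hφ hj h0
    simp only [SetLike.mem_coe]
    rw [hy, show (2 : ℂ) * crossed φ y = (2 : ℤ) • crossed φ y by simp]
    exact Submodule.smul_mem_smul (Ideal.mem_span_singleton_self _) (crossed_mem_span hφ y)
  -- Nakayama: `L ≤ 2L` with `L` finitely generated yields an odd integer `r` killing `L`; since `ℂ`
  -- is torsion-free, `L = 0`.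
  obtain ⟨r, hr, hr0⟩ := Submodule.exists_sub_one_mem_and_smul_eq_zero_of_fg_of_le_smul _ L
    (Submodule.fg_span (Set.finite_range _)) hle
  have := hr0 _ (Submodule.subset_span ⟨i, rfl⟩)
  rcases smul_eq_zero.1 this with h | h
  · rw [h, Ideal.mem_span_singleton] at hr
    norm_num at hr
  · exact h

/-- The values on the generators of a homomorphism to an abelian group may be prescribed freely
on the conjugacy classes of generators. -/
theorem exists_hom_gen_eq {A : Type*} [CommGroup A] (u : Fin P.m → A)
    (hu : ∀ i j, IsConj (P.gen i) (P.gen j) → u i = u j) :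
    ∃ f : P.Carrier →* A, ∀ i, f (P.gen i) = u i := by
  have hr : ∀ r ∈ P.relators, FreeGroup.lift u r = 1 := by
    rintro r ⟨i, j, k, rfl⟩
    have hij : u i = u j := by
      refine hu i j ((isConj_iff.2 ⟨(PresentedGroup.mk P.relators (P.w i j k))⁻¹, ?_⟩ :
        IsConj (P.gen j) (P.gen i)).symm)
      rw [inv_inv, ← gen_eq_conj]
    simp [hij, mul_comm]
  exact ⟨PresentedGroup.toGroup hr, fun i => PresentedGroup.toGroup.of hr⟩

theorem chi_one (g : P.Carrier) : P.chi 1 g = 1 := by simp [chi]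

/-- Both dimensions are compared with the number of classes of generators other than that of `x₀`,
where crossed homomorphisms vanish by normalisation. -/
theorem finrank_eigenHom_neg_one_le :
    Module.finrank ℂ (P.eigenHom (-1)) ≤ Module.finrank ℂ (P.eigenHom 1) := by
  classical
  let s : Setoid (Fin P.m) := (IsConj.setoid P.Carrier).comap P.gen
  have hs {i j : Fin P.m} : (⟦i⟧ : Quotient s) = ⟦j⟧ ↔ IsConj (P.gen i) (P.gen j) := Quotient.eq
  let i₀ : Fin P.m := ⟨0, P.m_pos⟩
  let T := {q : Quotient s // q ≠ ⟦i₀⟧}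
  let τ : T → Fin P.m := fun q => q.1.out
  let _ : Fintype T := Fintype.ofFinite T
  refine (finrank_eigenHom_le τ fun φ hφ h => crossed_gen_eq_zero hφ fun i => ?_).trans
    (le_finrank_eigenHom τ fun u => ?_)
  · by_cases hi : (⟦i⟧ : Quotient s) = ⟦i₀⟧
    · exact ⟨i₀, hs.1 hi.symm, crossed_base φ⟩
    · exact ⟨τ ⟨⟦i⟧, hi⟩, hs.1 (Quotient.out_eq _), h _⟩
  · let v : Fin P.m → ℂ := fun i => if h : (⟦i⟧ : Quotient s) = ⟦i₀⟧ then 0 else u ⟨⟦i⟧, h⟩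
    have hv {i j : Fin P.m} (h : (⟦i⟧ : Quotient s) = ⟦j⟧) : v i = v j := by
      simp only [v, h]
    obtain ⟨f, hf⟩ := exists_hom_gen_eq (fun i => Multiplicative.ofAdd (v i))
      fun i j h => congrArg _ (hv (hs.2 h))
    refine ⟨fun g => (f g).toAdd, fun g g' => ?_, ?_, fun t => ?_⟩
    · simp [chi_one]
    · simp only [base, hf]
      simp [v, i₀]
    · simp only [hf]
      have h : (⟦τ t⟧ : Quotient s) = t.1 := Quotient.out_eq _
      simp only [toAdd_ofAdd, v, h, dif_neg t.2]
      rfl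

theorem alexander_eq [Module.Finite ℂ (ℂ ⊗[ℤ] P.NAb)] :
    P.alexander = (-1) ^ Module.finrank ℂ (ℂ ⊗[ℤ] P.NAb) * P.hC.charpoly :=
  dif_pos ‹_›

theorem monic_sub_one_pow_mul_add_one_pow (n k : ℕ) :
    ((X - 1) ^ n * (X + 1) ^ k : ℂ[X]).Monic :=
  ((monic_X_sub_C (1 : ℂ)).pow n).mul ((monic_X_add_C (1 : ℂ)).pow k)

theorem IsHurwitz.le_of_alexander_eq (hP : P.IsHurwitz) {n k : ℕ}
    (h : P.alexander = (-1 : ℂ[X]) ^ (n + k) * (X - 1) ^ n * (X + 1) ^ k) : k ≤ n := by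
  rw [mul_assoc] at h
  have hm := monic_sub_one_pow_mul_add_one_pow n k
  by_cases hfin : Module.Finite ℂ (ℂ ⊗[ℤ] P.NAb)
  · obtain ⟨z, hz, d, hd, hν⟩ := hP.exists_mem_center
    rw [alexander_eq] at h
    have hc := eq_of_neg_one_pow_mul_eq P.hC.charpoly_monic hm h
    have hr := rootMultiplicity_charpoly_of_pow_eq_one hd
      (hC_pow_eq_one (conjAction_pow_eq_one hz hν))
    obtain ⟨h1, h2⟩ := rootMultiplicity_sub_one_pow_mul_add_one_pow (K := ℂ) n k
    rw [← hc, hr] at h1 h2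
    rw [← h1, ← h2]
    have e1 := finrank_eigenspace_hC (P := P) 1
    have e2 := finrank_eigenspace_hC (P := P) (-1)
    rw [Units.val_one] at e1
    rw [Units.val_neg, Units.val_one] at e2
    rw [e1, e2]
    exact finrank_eigenHom_neg_one_le
  · rw [alexander, dif_neg hfin] at h
    exact absurd h.symm (mul_ne_zero (pow_ne_zero _ (by simp)) hm.ne_zero)

end CGroup

/-! ### Sufficiency: the groups `pairGroup n k` -/

theorem List.prod_ofFn_eq_one_of_pairs {H : Type*} [Group H] (N : ℕ) (u : ℕ → H)
    (hu : ∀ s, u (2 * s) * u (2 * s + 1) = 1) :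
    (List.ofFn fun i : Fin (2 * N) => u i).prod = 1 := by
  induction N generalizing u with
  | zero => simp
  | succ N ih =>
    have h := ih (fun s => u (s + 2)) fun s => hu (s + 1)
    change (List.ofFn (n := 2 * N + 1 + 1) fun i => u i).prod = 1
    rw [List.ofFn_succ, List.ofFn_succ, List.prod_cons, List.prod_cons, ← mul_assoc]
    have h0 := hu 0
    simp only [mul_zero, zero_add] at h0
    simp only [Fin.val_zero, Fin.val_succ, zero_add, h0, one_mul]
    exact h

namespace CGroup

/-- The words which are made central in `pairGroup n k`: the product of all the generators, the
squares of `x_i` for `i / 2 ≤ k`, and `x_i x_0⁻¹` for `i / 2 > k`. -/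
def pairWord (n k : ℕ) : Fin (2 * (n + 1) + 1) → FreeGroup (Fin (2 * (n + 1))) :=
  Fin.cons (List.ofFn fun j => FreeGroup.of j).prod fun i =>
    if i.val / 2 ≤ k then FreeGroup.of i ^ 2
    else FreeGroup.of i * (FreeGroup.of ⟨0, Nat.succ_pos _⟩)⁻¹

/-- A Hurwitz `C`-group on `2 (n + 1)` generators, equal in pairs, in which the words `pairWord n k`
are central. -/
abbrev pairGroup (n k : ℕ) : CGroup where
  m := 2 * (n + 1)
  m_pos := Nat.succ_pos _
  h i j := if i.val / 2 = j.val / 2 then 2 * (n + 1) + 1 else 0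
  -- The words do not depend on `i, j`: the relations with `i = j` make them central, and those
  -- between partners then identify the two generators.
  w i j t := pairWord n k ⟨t.val, t.2.trans_le (by split <;> simp)⟩

variable {n k : ℕ}

theorem pairGroup_gen_eq_conj {i j : Fin (2 * (n + 1))} (h : i.val / 2 = j.val / 2)
    (t : Fin (2 * (n + 1) + 1)) :
    (pairGroup n k).gen i = (PresentedGroup.mk (pairGroup n k).relators (pairWord n k t))⁻¹ *
      (pairGroup n k).gen j * PresentedGroup.mk (pairGroup n k).relators (pairWord n k t) :=
  gen_eq_conj (P := pairGroup n k) i j ⟨t.val, t.2.trans_eq (if_pos h).symm⟩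

theorem mk_pairWord_mem_center (t : Fin (2 * (n + 1) + 1)) :
    PresentedGroup.mk (pairGroup n k).relators (pairWord n k t) ∈
      Subgroup.center (pairGroup n k).Carrier := by
  refine mem_center_of_commute_gen fun i => ?_
  have h := pairGroup_gen_eq_conj (k := k) (rfl : i.val / 2 = i.val / 2) t
  rw [mul_assoc, eq_inv_mul_iff_mul_eq] at h
  exact h

theorem pairGroup_gen_congr {i j : Fin (2 * (n + 1))} (h : i.val / 2 = j.val / 2) :
    (pairGroup n k).gen i = (pairGroup n k).gen j := by
  rw [pairGroup_gen_eq_conj h 0, mul_assoc,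
    Subgroup.mem_center_iff.1 (mk_pairWord_mem_center 0), inv_mul_cancel_left]

theorem isHurwitz_pairGroup : (pairGroup n k).IsHurwitz := by
  refine ⟨pairGroup n k, fun i => ⟨?_, ?_⟩, MulEquiv.refl _, fun _ => Iff.rfl⟩
  · simp
  · rfl

theorem gen_sq_mem_center {i : Fin (2 * (n + 1))} (hi : i.val / 2 ≤ k) :
    (pairGroup n k).gen i ^ 2 ∈ Subgroup.center (pairGroup n k).Carrier := by
  have h := mk_pairWord_mem_center (k := k) i.succ
  rw [pairWord, Fin.cons_succ, if_pos hi, map_pow] at h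
  exact h

theorem gen_mul_base_inv_mem_center {i : Fin (2 * (n + 1))} (hi : k < i.val / 2) :
    (pairGroup n k).gen i * (pairGroup n k).base⁻¹ ∈
      Subgroup.center (pairGroup n k).Carrier := by
  have h := mk_pairWord_mem_center (k := k) i.succ
  rw [pairWord, Fin.cons_succ, if_neg hi.not_ge, map_mul, map_inv] at h
  exact h

theorem conjAction_pairGroup_sq :
    ((pairGroup n k).conjAction (pairGroup n k).base ^ 2 :
      Module.End ℤ (pairGroup n k).NAb) = 1 := by
  refine conjAction_pow_eq_one (gen_sq_mem_center (i := ⟨0, Nat.succ_pos _⟩) (by simp)) ?_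
  rw [map_pow, nu_gen]
  rfl

theorem exists_pairGroup_hom {H : Type*} [Group H] (c : ℕ → H)
    (hc : ∀ t s, Commute (FreeGroup.lift (fun i : Fin (2 * (n + 1)) => c (i.val / 2))
      (pairWord n k t)) (c s)) :
    ∃ f : (pairGroup n k).Carrier →* H,
      ∀ i : Fin (2 * (n + 1)), f ((pairGroup n k).gen i) = c (i.val / 2) := by
  have hr : ∀ r ∈ (pairGroup n k).relators,
      FreeGroup.lift (fun i : Fin (2 * (n + 1)) => c (i.val / 2)) r = 1 := by
    rintro r ⟨i, j, t, rfl⟩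
    have ht : (0 : ℕ) < if i.val / 2 = j.val / 2 then 2 * (n + 1) + 1 else 0 := t.pos
    have hij : i.val / 2 = j.val / 2 := by
      by_contra h
      simp [h] at ht
    rw [map_mul, map_mul, map_mul, map_inv, map_inv, FreeGroup.lift_apply_of,
      FreeGroup.lift_apply_of, hij, inv_mul_eq_one, mul_assoc]
    exact eq_inv_mul_iff_mul_eq.2 (hc ⟨t, t.2.trans_eq (if_pos hij)⟩ _)
  exact ⟨PresentedGroup.toGroup hr, fun i => PresentedGroup.toGroup.of hr⟩

theorem exists_crossed_one (c : ℕ → ℂ) (h0 : c 0 = 0) :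
    ∃ f : (pairGroup n k).Carrier → ℂ,
      (∀ g g', f (g * g') = f g + (pairGroup n k).chi 1 g * f g') ∧
      f (pairGroup n k).base = 0 ∧
      ∀ i : Fin (2 * (n + 1)), f ((pairGroup n k).gen i) = c (i.val / 2) := by
  obtain ⟨f, hf⟩ := exists_pairGroup_hom (n := n) (k := k)
    (fun s => Multiplicative.ofAdd (c s)) fun t s => Commute.all _ _
  refine ⟨fun g => (f g).toAdd, fun g g' => by simp [chi_one], ?_, fun i => ?_⟩
  · simp only [base, hf, Nat.zero_div, h0, ofAdd_zero, toAdd_one]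
  · simp only [hf, toAdd_ofAdd]

theorem subLeft_mul_self (a : ℂ) :
    (Equiv.subLeft a * Equiv.subLeft a : Equiv.Perm ℂ) = 1 := by
  ext z
  simp

/-- Generators go to reflections `z ↦ c - z`. These are involutions, so equal partners cancel in the
full product; for `i / 2 > k` the generator acts as `x_0` does. -/
theorem lift_pairWord_subLeft (c : ℕ → ℂ) (h0 : c 0 = 0) (hc : ∀ s, k < s → c s = 0)
    (t : Fin (2 * (n + 1) + 1)) :
    FreeGroup.lift (fun i : Fin (2 * (n + 1)) => (Equiv.subLeft (c (i.val / 2)) : Equiv.Perm ℂ))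
      (pairWord n k t) = 1 := by
  induction t using Fin.cases with
  | zero =>
    rw [pairWord, Fin.cons_zero, map_list_prod, List.map_ofFn]
    have h := List.prod_ofFn_eq_one_of_pairs (n + 1)
      (fun i => (Equiv.subLeft (c (i / 2)) : Equiv.Perm ℂ)) fun s => by
        have h1 : (2 * s) / 2 = s := by omega
        have h2 : (2 * s + 1) / 2 = s := by omega
        simp only [h1, h2, subLeft_mul_self]
    rw [← h]
    congr 2
  | succ i =>
    rw [pairWord, Fin.cons_succ]
    split_ifs with hi
    · rw [map_pow, FreeGroup.lift_apply_of, pow_two, subLeft_mul_self]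
    · rw [map_mul, map_inv, FreeGroup.lift_apply_of, FreeGroup.lift_apply_of,
        hc _ (not_le.1 hi)]
      simp [h0]

theorem exists_crossed_neg_one (c : ℕ → ℂ) (h0 : c 0 = 0) (hc : ∀ s, k < s → c s = 0) :
    ∃ f : (pairGroup n k).Carrier → ℂ,
      (∀ g g', f (g * g') = f g + (pairGroup n k).chi (-1) g * f g') ∧
      f (pairGroup n k).base = 0 ∧
      ∀ i : Fin (2 * (n + 1)), f ((pairGroup n k).gen i) = c (i.val / 2) := by
  obtain ⟨ρ, hρ⟩ := exists_pairGroup_hom (n := n) (k := k)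
    (fun s => (Equiv.subLeft (c s) : Equiv.Perm ℂ)) fun t s => by
      rw [lift_pairWord_subLeft c h0 hc]
      exact Commute.one_left _
  -- The action is affine with linear part `χ`; its translation part `ρ g 0` is the desired crossed
  -- homomorphism.
  have key : ∀ g z, ρ g z = ρ g 0 + (pairGroup n k).chi (-1) g * z := by
    intro g
    have hg : g ∈ Subgroup.closure (Set.range (pairGroup n k).gen) := by
      rw [closure_range_gen]
      trivial
    induction hg using Subgroup.closure_induction with
    | mem x hx =>
      obtain ⟨i, rfl⟩ := hx
      intro z
      rw [hρ i, chi_gen]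
      simp [sub_eq_add_neg]
    | one => simp
    | mul x y _ _ hx hy =>
      intro z
      rw [map_mul, Equiv.Perm.mul_apply, Equiv.Perm.mul_apply, hy z, hx (_ + _), hx (ρ y 0),
        map_mul, Units.val_mul]
      ring
    | inv x _ hx =>
      intro z
      have h1 := hx (ρ x⁻¹ z)
      have h2 := hx (ρ x⁻¹ 0)
      rw [map_inv, Equiv.Perm.inv_def, Equiv.apply_symm_apply] at h1 h2
      have h3 : ((pairGroup n k).chi (-1) x : ℂ) ≠ 0 := Units.ne_zero _
      rw [map_inv, map_inv, Units.val_inv_eq_inv_val]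
      field_simp
      linear_combination h2 - h1
  refine ⟨fun g => ρ g 0, fun g g' => ?_, ?_, fun i => ?_⟩
  · simp only [map_mul, Equiv.Perm.mul_apply]
    exact key _ _
  · simp only [base, hρ]
    simp [h0]
  · simp only [hρ]
    simp

/-- For the central `y = x_i x_0⁻¹`, expanding `f (y x_0) = f (x_0 y)` gives `f y = -f y`. -/
theorem crossed_gen_eq_zero_of_lt {φ : (pairGroup n k).NAb →ₗ[ℤ] ℂ}
    (hφ : φ ∈ (pairGroup n k).eigenHom (-1)) {i : Fin (2 * (n + 1))} (hi : k < i.val / 2) :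
    crossed φ ((pairGroup n k).gen i) = 0 := by
  have hz := gen_mul_base_inv_mem_center hi
  set y := (pairGroup n k).gen i * (pairGroup n k).base⁻¹ with hy
  have hχ : (pairGroup n k).chi (-1) y = 1 := by
    rw [hy, map_mul, map_inv, chi_base, chi_gen, mul_inv_cancel]
  have h1 : crossed φ (y * (pairGroup n k).base) = crossed φ y := by
    rw [crossed_mul hφ, crossed_base, mul_zero, add_zero]
  have h2 : crossed φ ((pairGroup n k).base * y) = -crossed φ y := by
    rw [crossed_mul hφ, crossed_base, chi_base]
    simp
  rw [Subgroup.mem_center_iff.1 hz, h1] at h2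
  have e : (pairGroup n k).gen i = y * (pairGroup n k).base := by simp [hy]
  rw [e, h1]
  exact self_eq_neg.1 h2

/-- Even-numbered generators, without the first one. -/
def evenGen (r : ℕ) (hr : r ≤ n) (t : Fin r) : Fin (2 * (n + 1)) :=
  ⟨2 * (t.val + 1), by omega⟩

theorem evenGen_div_two {r : ℕ} (hr : r ≤ n) (t : Fin r) : (evenGen r hr t).val / 2 = t + 1 := by
  simp [evenGen]

theorem le_finrank_pairGroup {μ : ℂˣ} {r : ℕ} (hr : r ≤ n)
    (h : ∀ c : ℕ → ℂ, c 0 = 0 → (∀ s, r < s → c s = 0) →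
      ∃ f : (pairGroup n k).Carrier → ℂ,
      (∀ g g', f (g * g') = f g + (pairGroup n k).chi μ g * f g') ∧
      f (pairGroup n k).base = 0 ∧
      ∀ i : Fin (2 * (n + 1)), f ((pairGroup n k).gen i) = c (i.val / 2)) :
    r ≤ Module.finrank ℂ ((pairGroup n k).eigenHom μ) := by
  conv_lhs => rw [← Fintype.card_fin r]
  refine le_finrank_eigenHom (evenGen r hr) fun u => ?_
  -- Pair `0` contains `x₀` and must take the value `0`, so `u` is shifted to pairs `1, …, r`.
  obtain ⟨f, h1, h2, h3⟩ := h (fun s => if h : 0 < s ∧ s - 1 < r then u ⟨s - 1, h.2⟩ else 0)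
    (by simp) fun s hs => dif_neg (by omega)
  refine ⟨f, h1, h2, fun t => ?_⟩
  rw [h3, evenGen_div_two, dif_pos ⟨Nat.succ_pos _, t.2⟩]
  rfl

theorem finrank_pairGroup_le {μ : ℂˣ} {r : ℕ} (hr : r ≤ n)
    (h : ∀ φ ∈ (pairGroup n k).eigenHom μ, ∀ i : Fin (2 * (n + 1)), r < i.val / 2 →
      crossed φ ((pairGroup n k).gen i) = 0) :
    Module.finrank ℂ ((pairGroup n k).eigenHom μ) ≤ r := by
  conv_rhs => rw [← Fintype.card_fin r]
  refine finrank_eigenHom_le (evenGen r hr) fun φ hφ h0 (i : Fin (2 * (n + 1))) => ?_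
  by_cases hi : r < i.val / 2
  · exact h φ hφ i hi
  by_cases hi0 : i.val / 2 = 0
  · rw [pairGroup_gen_congr (j := ⟨0, Nat.succ_pos _⟩) (by simpa using hi0)]
    exact crossed_base φ
  · have ht : i.val / 2 - 1 < r := by omega
    rw [pairGroup_gen_congr (j := evenGen r hr ⟨_, ht⟩) (by rw [evenGen_div_two]; simp; omega)]
    exact h0 _

theorem alexander_pairGroup (hk : k ≤ n) :
    (pairGroup n k).alexander = (-1 : ℂ[X]) ^ (n + k) * (X - 1) ^ n * (X + 1) ^ k := by
  have hsq := conjAction_pairGroup_sq (n := n) (k := k)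
  have := finite_of_conjAction_sq_eq_one hsq
  have e1 : Module.finrank ℂ (Module.End.eigenspace (pairGroup n k).hC 1) = n := by
    have e := finrank_eigenspace_hC (P := pairGroup n k) 1
    rw [Units.val_one] at e
    rw [e]
    exact (finrank_pairGroup_le le_rfl fun _ _ i hi => by omega).antisymm
      (le_finrank_pairGroup le_rfl fun c h0 _ => exists_crossed_one c h0)
  have e2 : Module.finrank ℂ (Module.End.eigenspace (pairGroup n k).hC (-1)) = k := by
    have e := finrank_eigenspace_hC (P := pairGroup n k) (-1)
    rw [Units.val_neg, Units.val_one] at e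
    rw [e]
    exact (finrank_pairGroup_le hk fun _ hφ _ hi => crossed_gen_eq_zero_of_lt hφ hi).antisymm
      (le_finrank_pairGroup hk exists_crossed_neg_one)
  have hc := charpoly_of_sq_eq_one (hC_pow_eq_one hsq)
  rw [e1, e2] at hc
  have hd : Module.finrank ℂ (ℂ ⊗[ℤ] (pairGroup n k).NAb) = n + k := by
    rw [← LinearMap.charpoly_natDegree (pairGroup n k).hC, hc]
    compute_degree!
  rw [alexander_eq, hd, hc, mul_assoc]

end CGroup

theorem theorem0p3 (n k : ℕ) :
    (∃ G : CGroup, G.IsHurwitz ∧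
      G.alexander = (-1 : ℂ[X]) ^ (n + k) * (X - 1) ^ n * (X + 1) ^ k) ↔ k ≤ n :=
  ⟨fun ⟨_, hG, h⟩ => hG.le_of_alexander_eq h,
    fun h => ⟨CGroup.pairGroup n k, CGroup.isHurwitz_pairGroup, CGroup.alexander_pairGroup h⟩⟩
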